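/- There is a universal constant $C \ge 1$ such that the following holds. Let $A, B$ be finite sets, let $\Delta \in \mathbb{N}$, and let $\mathbf{M} \in \{0,1,\dots,\Delta\}^{A \times B}$ be a matrix whose rank over $\mathbb{R}$ is $r \ge 2$. Then there are $A' \subseteq A$ and $B' \subseteq B$ such that at least a $\left(1-\frac{1}{16r}\right)$-fraction of the entries of the submatrix $\mathbf{M}[A',B']$ have the same value, and $$|A'|\,|B'| \;\ge\; |A|\,|B| \cdot \exp\!\left(-C\,\Delta^{C\Delta}\,\sqrt{r}\,\log r\right).$$ -/

import Mathlib

/-- The rectangle `M[A', B']` is `(1 - ε)`-monochromatic: at least a `(1 - ε)`-fraction of its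
entries have the same value. -/
def IsAlmostMonochromatic {A B α : Type*} [DecidableEq α] (M : Matrix A B α)
    (A' : Finset A) (B' : Finset B) (ε : ℝ) : Prop :=
  ∃ c : α, (1 - ε) * ((A'.card : ℝ) * (B'.card : ℝ)) ≤
    (((A' ×ˢ B').filter (fun p => M p.1 p.2 = c)).card : ℝ)

/-!
An optimal design, maximizing the determinant of the information matrix of the rows in a rank
factorization, shows that `γ₂(M)` is at most `√(rank M)` times the largest entry of `M`. Rounding
the resulting vectors along a Gaussian direction expresses an increasing function of the entries of
`M`, bounded below by `1 / 4`, as a mixture of rectangles. Its powers are mixtures of rectangles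
again, and at a power of order `γ₂(M)` distinct values of `M` get weights far apart. There are few
values, so by the pigeonhole principle some further power makes one value `m` outweigh all others
together. Testing that mixture against the functional equal to `1` on the entries `m` and to `-ε⁻¹`
elsewhere yields the rectangle.
-/

open Matrix MeasureTheory ProbabilityTheory
open scoped RealInnerProductSpace

theorem exists_rank_factorization {K A B : Type*} [Field K] [Finite A] [Fintype B]
    (M : Matrix A B K) :
    ∃ (X : Matrix A (Fin M.rank) K) (Y : Matrix (Fin M.rank) B K),
      M = X * Y ∧ Function.Injective X.mulVec := by
  classical
  have := Fintype.ofFinite A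
  let b : Module.Basis (Fin M.rank) K (LinearMap.range M.mulVecLin) := Module.finBasis K _
  refine ⟨LinearMap.toMatrix b (Pi.basisFun K A) (LinearMap.range M.mulVecLin).subtype,
    LinearMap.toMatrix (Pi.basisFun K B) b M.mulVecLin.rangeRestrict, ?_, ?_⟩
  · rw [← LinearMap.toMatrix_comp, LinearMap.subtype_comp_codRestrict]
    exact (LinearMap.toMatrix'_toLin' M).symm
  · intro c d hcd
    obtain ⟨x, rfl⟩ := b.equivFun.surjective c
    obtain ⟨y, rfl⟩ := b.equivFun.surjective d
    simp only [Module.Basis.equivFun_apply, LinearMap.toMatrix_mulVec_repr] at hcd ⊢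
    rw [Subtype.ext (DFunLike.coe_injective.comp (Pi.basisFun K A).repr.injective hcd)]

theorem exists_isUnit_transpose_mul_mul_eq_one {n : Type*} [Fintype n] [DecidableEq n]
    {S : Matrix n n ℝ} (hS : S.PosDef) :
    ∃ P : Matrix n n ℝ, IsUnit P ∧ Pᵀ * S * P = 1 := by
  open scoped MatrixOrder in
  obtain ⟨B, hB, rfl⟩ :=
    CStarAlgebra.isStrictlyPositive_iff_eq_star_mul_self.1 hS.isStrictlyPositive
  have hBdet := (isUnit_iff_isUnit_det B).1 hB
  refine ⟨B⁻¹, isUnit_nonsing_inv_iff.2 hB, ?_⟩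
  rw [star_eq_conjTranspose, conjTranspose_eq_transpose_of_trivial, transpose_nonsing_inv,
    nonsing_inv_mul_cancel_left _ _ (by rwa [det_transpose]), mul_nonsing_inv _ hBdet]

theorem le_of_forall_one_add_mul_le_one_add_pow {q : ℝ} {r : ℕ}
    (h : ∀ s : ℝ, 0 < s → 1 + s * q ≤ (1 + s) ^ r) : q ≤ r := by
  have hderiv : HasDerivAt (fun s : ℝ => (1 + s) ^ r) r 0 := by
    simpa using ((hasDerivAt_id (0 : ℝ)).const_add 1).fun_pow r
  refine ge_of_tendsto hderiv.tendsto_slope_zero_right ?_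
  filter_upwards [self_mem_nhdsWithin] with s (hs : 0 < s)
  rw [smul_eq_mul, ← div_eq_inv_mul, le_div_iff₀ hs, zero_add, add_zero, one_pow]
  linarith [h s hs]

section InformationMatrix

variable {A n : Type*} [Fintype A] [DecidableEq A]

/-- The information matrix `∑ a, l a • (X a)(X a)ᵀ` of the design that weights the rows of `X`
by `l`. -/
def informationMatrix (X : Matrix A n ℝ) (l : A → ℝ) : Matrix n n ℝ :=
  Xᵀ * diagonal l * X

theorem informationMatrix_add (X : Matrix A n ℝ) (l l' : A → ℝ) :
    informationMatrix X (l + l') = informationMatrix X l + informationMatrix X l' := by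
  simp only [informationMatrix, Pi.add_def, ← diagonal_add, Matrix.mul_add, Matrix.add_mul]

theorem informationMatrix_smul (X : Matrix A n ℝ) (c : ℝ) (l : A → ℝ) :
    informationMatrix X (c • l) = c • informationMatrix X l := by
  simp only [informationMatrix, diagonal_smul, Matrix.mul_smul, Matrix.smul_mul]

theorem informationMatrix_single (X : Matrix A n ℝ) (a : A) :
    informationMatrix X (Pi.single a 1) = vecMulVec (X a) (X a) := by
  ext i j
  simp [informationMatrix, mul_apply, diagonal_apply, Pi.single_apply, vecMulVec_apply]

variable [Fintype n]

theorem informationMatrix_mul_right (X : Matrix A n ℝ) (P : Matrix n n ℝ) (l : A → ℝ) :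
    informationMatrix (X * P) l = Pᵀ * informationMatrix X l * P := by
  simp only [informationMatrix, transpose_mul, Matrix.mul_assoc]

theorem dotProduct_informationMatrix_mulVec (X : Matrix A n ℝ) (l : A → ℝ) (y : n → ℝ) :
    y ⬝ᵥ (informationMatrix X l *ᵥ y) = ∑ a, l a * (X *ᵥ y) a ^ 2 := by
  rw [informationMatrix, Matrix.mul_assoc, ← mulVec_mulVec, dotProduct_mulVec, vecMul_transpose,
    ← mulVec_mulVec]
  simp only [dotProduct, mulVec_diagonal]
  exact Finset.sum_congr rfl fun a _ => by ring

variable [DecidableEq n]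

theorem exists_posDef_isMaxOn_det_informationMatrix [Nonempty A] {X : Matrix A n ℝ}
    (hX : Function.Injective X.mulVec) :
    ∃ l ∈ stdSimplex ℝ A, (informationMatrix X l).PosDef ∧
      IsMaxOn (fun l => (informationMatrix X l).det) (stdSimplex ℝ A) l := by
  have hcont : Continuous fun l => (informationMatrix X l).det := by
    unfold informationMatrix
    fun_prop
  obtain ⟨l, hl, hmax⟩ := (isCompact_stdSimplex ℝ A).exists_isMaxOn
    ⟨_, single_mem_stdSimplex ℝ (Classical.arbitrary A)⟩ hcont.continuousOn
  have huniform : 0 < (informationMatrix X (stdSimplex.barycenter : stdSimplex ℝ A)).det := by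
    refine (PosDef.conjTranspose_mul_mul_same (.diagonal fun _ => ?_) hX).det_pos
    exact inv_pos.2 (Nat.cast_pos.2 Fintype.card_pos)
  have hpsd : (informationMatrix X l).PosSemidef :=
    (PosSemidef.diagonal hl.1).conjTranspose_mul_mul_same X
  exact ⟨l, hl, hpsd.posDef_iff_det_ne_zero.2 (huniform.trans_le (hmax (Subtype.prop _))).ne',
    hmax⟩

theorem dotProduct_self_row_le_card_of_isMaxOn {X : Matrix A n ℝ} {l : A → ℝ}
    (hl : l ∈ stdSimplex ℝ A) (hone : informationMatrix X l = 1)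
    (hmax : IsMaxOn (fun l => (informationMatrix X l).det) (stdSimplex ℝ A) l) (a : A) :
    X a ⬝ᵥ X a ≤ Fintype.card n := by
  -- First-order optimality of the determinant when mass is moved from `l` to the point `a`.
  refine le_of_forall_one_add_mul_le_one_add_pow fun s hs => ?_
  have hmem : (1 + s)⁻¹ • (l + s • Pi.single a 1) ∈ stdSimplex ℝ A := by
    have := convex_stdSimplex ℝ A hl (single_mem_stdSimplex ℝ a)
      (a := (1 + s)⁻¹) (b := (1 + s)⁻¹ * s) (by positivity) (by positivity) (by field_simp)
    rwa [smul_add, smul_smul]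
  have hdet : (informationMatrix X ((1 + s)⁻¹ • (l + s • Pi.single a 1))).det =
      ((1 + s) ^ Fintype.card n)⁻¹ * (1 + s * (X a ⬝ᵥ X a)) := by
    rw [informationMatrix_smul, informationMatrix_add, informationMatrix_smul, hone,
      informationMatrix_single, ← smul_vecMulVec, vecMulVec_eq Unit, det_smul,
      det_one_add_replicateCol_mul_replicateRow, dotProduct_smul, smul_eq_mul, inv_pow]
  have hle : ((1 + s) ^ Fintype.card n)⁻¹ * (1 + s * (X a ⬝ᵥ X a)) ≤ 1 := by
    simpa only [Set.mem_ofPred_eq, hdet, hone, det_one] using hmax hmem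
  rwa [inv_mul_le_one₀ (by positivity)] at hle

theorem exists_isotropic_design [Nonempty A] {X : Matrix A n ℝ}
    (hX : Function.Injective X.mulVec) :
    ∃ P : Matrix n n ℝ, IsUnit P ∧ ∃ l ∈ stdSimplex ℝ A, informationMatrix (X * P) l = 1 ∧
      ∀ a, (X * P) a ⬝ᵥ (X * P) a ≤ Fintype.card n := by
  obtain ⟨l, hl, hpos, hmax⟩ := exists_posDef_isMaxOn_det_informationMatrix hX
  obtain ⟨P, hP, hone⟩ := exists_isUnit_transpose_mul_mul_eq_one hpos
  rw [← informationMatrix_mul_right] at hone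
  refine ⟨P, hP, l, hl, hone, dotProduct_self_row_le_card_of_isMaxOn hl hone fun l' hl' => ?_⟩
  have hdet (l : A → ℝ) :
      (informationMatrix (X * P) l).det = P.det ^ 2 * (informationMatrix X l).det := by
    rw [informationMatrix_mul_right, det_mul, det_mul, det_transpose]
    ring
  simp only [Set.mem_ofPred_eq, hdet]
  gcongr
  exact hmax hl'

end InformationMatrix

/-- The factorization norm `γ₂(M)` is at most `γ`: up to the factor `γ`, the entries of `M` are
inner products of vectors in a Euclidean unit ball. -/
def GammaTwoLE {A B : Type*} (M : Matrix A B ℝ) (γ : ℝ) : Prop :=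
  ∃ (k : ℕ) (u : A → EuclideanSpace ℝ (Fin k)) (v : B → EuclideanSpace ℝ (Fin k)),
    (∀ a, ‖u a‖ ≤ 1) ∧ (∀ b, ‖v b‖ ≤ 1) ∧ ∀ a b, M a b = γ * ⟪u a, v b⟫

section GammaTwo

variable {A B : Type*} {M : Matrix A B ℝ}

theorem GammaTwoLE.mono {γ γ' : ℝ} (h : GammaTwoLE M γ) (hγ : |γ| ≤ γ') : GammaTwoLE M γ' := by
  obtain ⟨k, u, v, hu, hv, hM⟩ := h
  refine ⟨k, fun a => (γ / γ') • u a, v, fun a => ?_, hv, fun a b => ?_⟩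
  · rw [norm_smul, Real.norm_eq_abs, abs_div]
    have : |γ| / |γ'| ≤ 1 := div_le_one_of_le₀ (hγ.trans (le_abs_self _)) (abs_nonneg _)
    exact mul_le_one₀ this (norm_nonneg _) (hu a)
  · rw [hM, real_inner_smul_left, ← mul_assoc]
    congr 1
    rcases eq_or_ne γ' 0 with rfl | hγ'
    · simpa using hγ
    · rw [mul_div_cancel₀ _ hγ']

theorem gammaTwoLE_of_inner {k : ℕ} {u : A → EuclideanSpace ℝ (Fin k)}
    {v : B → EuclideanSpace ℝ (Fin k)} {α β : ℝ} (hα : 0 ≤ α) (hβ : 0 ≤ β)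
    (hu : ∀ a, ‖u a‖ ≤ α) (hv : ∀ b, ‖v b‖ ≤ β) (hM : ∀ a b, M a b = ⟪u a, v b⟫) :
    GammaTwoLE M (α * β) := by
  have hnorm {δ : ℝ} (hδ : 0 ≤ δ) {w : EuclideanSpace ℝ (Fin k)} (hw : ‖w‖ ≤ δ) :
      ‖δ⁻¹ • w‖ ≤ 1 := by
    rw [norm_smul, norm_inv, Real.norm_of_nonneg hδ]
    exact inv_mul_le_one_of_le₀ hw hδ
  have hsmul {δ : ℝ} {w : EuclideanSpace ℝ (Fin k)} (hw : ‖w‖ ≤ δ) : δ • δ⁻¹ • w = w := by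
    rcases eq_or_ne δ 0 with rfl | hδ
    · rw [norm_le_zero_iff.1 hw, smul_zero, smul_zero]
    · rw [smul_inv_smul₀ hδ]
  refine ⟨k, fun a => α⁻¹ • u a, fun b => β⁻¹ • v b, fun a => hnorm hα (hu a),
    fun b => hnorm hβ (hv b), fun a b => ?_⟩
  rw [hM, mul_assoc, ← real_inner_smul_right, ← real_inner_smul_left, hsmul (hu a), hsmul (hv b)]

theorem norm_toLp_le_of_dotProduct_self_le {n : Type*} [Fintype n] {w : n → ℝ} {c : ℝ}
    (hc : 0 ≤ c) (hw : w ⬝ᵥ w ≤ c ^ 2) : ‖WithLp.toLp 2 w‖ ≤ c := by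
  refine le_of_sq_le_sq ?_ hc
  rw [EuclideanSpace.real_norm_sq_eq]
  simpa only [dotProduct, ← pow_two] using hw

theorem gammaTwoLE_sqrt_rank_mul [Finite A] [Fintype B] {D : ℝ} (hD : 0 ≤ D)
    (hM : ∀ a b, |M a b| ≤ D) : GammaTwoLE M (√M.rank * D) := by
  classical
  have := Fintype.ofFinite A
  cases isEmpty_or_nonempty A
  · exact ⟨0, isEmptyElim, 0, isEmptyElim, by simp, isEmptyElim⟩
  obtain ⟨X, Y, hXY, hX⟩ := exists_rank_factorization M
  obtain ⟨P, hP, l, hl, hone, hrow⟩ := exists_isotropic_design hX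
  have hentry (a : A) (b : B) : ((X * P) *ᵥ (P⁻¹ *ᵥ Yᵀ b)) a = M a b := by
    rw [mulVec_mulVec, mul_nonsing_inv_cancel_right _ _ ((isUnit_iff_isUnit_det P).1 hP)]
    exact (congr_fun₂ hXY a b).symm
  refine gammaTwoLE_of_inner (u := fun a => WithLp.toLp 2 ((X * P) a))
    (v := fun b => WithLp.toLp 2 (P⁻¹ *ᵥ Yᵀ b)) (Real.sqrt_nonneg _) hD
    (fun a => norm_toLp_le_of_dotProduct_self_le (Real.sqrt_nonneg _) ?_)
    (fun b => norm_toLp_le_of_dotProduct_self_le hD ?_) fun a b => ?_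
  · simpa only [Real.sq_sqrt (Nat.cast_nonneg _), Fintype.card_fin] using hrow a
  · calc (P⁻¹ *ᵥ Yᵀ b) ⬝ᵥ (P⁻¹ *ᵥ Yᵀ b) = ∑ a, l a * M a b ^ 2 := by
          simpa only [hone, one_mulVec, hentry] using
            dotProduct_informationMatrix_mulVec (X * P) l (P⁻¹ *ᵥ Yᵀ b)
      _ ≤ ∑ a, l a * D ^ 2 := by
          refine Finset.sum_le_sum fun a _ => mul_le_mul_of_nonneg_left ?_ (hl.1 a)
          exact sq_le_sq' (abs_le.1 (hM a b)).1 (abs_le.1 (hM a b)).2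
      _ = D ^ 2 := by rw [← Finset.sum_mul, hl.2, one_mul]
  · rw [EuclideanSpace.inner_toLp_toLp, star_trivial, dotProduct_comm, ← hentry a b]
    rfl

end GammaTwo
/-- `W` is a convex combination of indicators of rectangles `A' ×ˢ B'`. The definition is the dual
one: every linear functional takes a value at least as large on some rectangle. -/
def IsRectangleMixture {A B : Type*} [Fintype A] [Fintype B] (W : A → B → ℝ) : Prop :=
  ∀ c : A → B → ℝ, ∃ (A' : Finset A) (B' : Finset B),
    ∑ a, ∑ b, c a b * W a b ≤ ∑ a ∈ A', ∑ b ∈ B', c a b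

theorem exists_finset_sum_mul_le {A : Type*} [Fintype A] (d : A → ℝ) {f : A → ℝ}
    (hf : ∀ a, f a ∈ Set.Icc (0 : ℝ) 1) : ∃ A' : Finset A, ∑ a, d a * f a ≤ ∑ a ∈ A', d a := by
  classical
  refine ⟨Finset.univ.filter fun a => 0 ≤ d a, ?_⟩
  rw [Finset.sum_filter]
  refine Finset.sum_le_sum fun a _ => ?_
  split_ifs with h
  · exact mul_le_of_le_one_right h (hf a).2
  · exact mul_nonpos_of_nonpos_of_nonneg (not_le.1 h).le (hf a).1

namespace IsRectangleMixture

variable {A B : Type*} [Fintype A] [Fintype B]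

theorem of_mem_Icc {f : A → ℝ} {h : B → ℝ} (hf : ∀ a, f a ∈ Set.Icc (0 : ℝ) 1)
    (hh : ∀ b, h b ∈ Set.Icc (0 : ℝ) 1) : IsRectangleMixture fun a b => f a * h b := by
  intro c
  obtain ⟨A', hA⟩ := exists_finset_sum_mul_le (fun a => ∑ b, c a b * h b) hf
  obtain ⟨B', hB⟩ := exists_finset_sum_mul_le (fun b => ∑ a ∈ A', c a b) hh
  refine ⟨A', B', ?_⟩
  calc ∑ a, ∑ b, c a b * (f a * h b) = ∑ a, (∑ b, c a b * h b) * f a := by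
        simp only [Finset.sum_mul, mul_assoc, mul_comm (f _)]
    _ ≤ ∑ a ∈ A', ∑ b, c a b * h b := hA
    _ = ∑ b, (∑ a ∈ A', c a b) * h b := by
        rw [Finset.sum_comm]
        simp only [Finset.sum_mul]
    _ ≤ ∑ b ∈ B', ∑ a ∈ A', c a b := hB
    _ = ∑ a ∈ A', ∑ b ∈ B', c a b := Finset.sum_comm

theorem mul {W₁ W₂ : A → B → ℝ} (h₁ : IsRectangleMixture W₁) (h₂ : IsRectangleMixture W₂) :
    IsRectangleMixture fun a b => W₁ a b * W₂ a b := by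
  classical
  intro c
  obtain ⟨A₁, B₁, hle₁⟩ := h₁ fun a b => c a b * W₂ a b
  obtain ⟨A₂, B₂, hle₂⟩ := h₂ fun a b => if a ∈ A₁ then if b ∈ B₁ then c a b else 0 else 0
  refine ⟨A₂ ∩ A₁, B₂ ∩ B₁, ?_⟩
  calc ∑ a, ∑ b, c a b * (W₁ a b * W₂ a b) = ∑ a, ∑ b, c a b * W₂ a b * W₁ a b := by
        simp only [mul_assoc, mul_comm (W₁ _ _)]
    _ ≤ ∑ a ∈ A₁, ∑ b ∈ B₁, c a b * W₂ a b := hle₁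
    _ = ∑ a, ∑ b, (if a ∈ A₁ then if b ∈ B₁ then c a b else 0 else 0) * W₂ a b := by
        simp [ite_mul, Finset.sum_ite_irrel]
    _ ≤ ∑ a ∈ A₂, ∑ b ∈ B₂, if a ∈ A₁ then if b ∈ B₁ then c a b else 0 else 0 := hle₂
    _ = ∑ a ∈ A₂ ∩ A₁, ∑ b ∈ B₂ ∩ B₁, c a b := by
        simp [Finset.sum_ite_irrel, Finset.sum_ite_mem]

theorem pow {W : A → B → ℝ} (h : IsRectangleMixture W) (n : ℕ) :
    IsRectangleMixture fun a b => W a b ^ n := by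
  induction n with
  | zero =>
    have hone : (1 : ℝ) ∈ Set.Icc (0 : ℝ) 1 := Set.right_mem_Icc.2 zero_le_one
    simpa only [pow_zero, mul_one] using of_mem_Icc (A := A) (B := B) (fun _ => hone) fun _ => hone
  | succ n ih => simpa only [pow_succ] using ih.mul h

theorem integral {Ω : Type*} [MeasurableSpace Ω] {μ : Measure Ω} [IsProbabilityMeasure μ]
    {W : Ω → A → B → ℝ} (hW : ∀ ω, IsRectangleMixture (W ω))
    (hint : ∀ a b, Integrable (fun ω => W ω a b) μ) :
    IsRectangleMixture fun a b => ∫ ω, W ω a b ∂μ := by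
  intro c
  have hintc (a : A) (b : B) : Integrable (fun ω => c a b * W ω a b) μ := (hint a b).const_mul _
  have hints (a : A) : Integrable (fun ω => ∑ b, c a b * W ω a b) μ :=
    integrable_finsetSum _ fun b _ => hintc a b
  obtain ⟨ω, hω⟩ := exists_integral_le (integrable_finsetSum Finset.univ fun a _ => hints a)
  obtain ⟨A', B', hle⟩ := hW ω c
  refine ⟨A', B', le_trans (le_of_eq ?_) (hω.trans hle)⟩
  simp only [integral_finsetSum _ fun a _ => hints a, integral_finsetSum _ fun b _ => hintc _ b,
    integral_const_mul]

end IsRectangleMixture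

section GaussianRounding

variable {E : Type*} [NormedAddCommGroup E] [InnerProductSpace ℝ E]

/-- The random weight in `[0, 1]` assigned to a vector `w` of norm at most `1` in one round of
rounding, as a function of the Gaussian direction `g`. The exponential factor compensates the
decay in `‖w‖` of the Gaussian Fourier transform. -/
noncomputable def gaussianRounding (w g : E) : ℝ :=
  (2 + Real.exp ((‖w‖ ^ 2 - 1) / 2) * (Real.cos ⟪g, w⟫ + Real.sin ⟪g, w⟫)) / 4

/-- The correlation `∫ g, gaussianRounding u g * gaussianRounding v g` as a function of
`s = ⟪u, v⟫`. -/
noncomputable def roundingWeight (s : ℝ) : ℝ :=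
  (4 + 4 * Real.exp (-1 / 2) + Real.exp (s - 1)) / 16

theorem gaussianRounding_mem_Icc {w : E} (hw : ‖w‖ ≤ 1) (g : E) :
    gaussianRounding w g ∈ Set.Icc (0 : ℝ) 1 := by
  have hexp : |Real.exp ((‖w‖ ^ 2 - 1) / 2)| ≤ 1 := by
    rw [Real.abs_exp, Real.exp_le_one_iff]
    linarith [pow_le_one₀ (n := 2) (norm_nonneg w) hw]
  have htrig : |Real.cos ⟪g, w⟫ + Real.sin ⟪g, w⟫| ≤ 2 :=
    (abs_add_le _ _).trans (by linarith [Real.abs_cos_le_one ⟪g, w⟫, Real.abs_sin_le_one ⟪g, w⟫])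
  have hprod := abs_le.1 ((abs_mul _ _).trans_le
    (mul_le_mul hexp htrig (abs_nonneg _) zero_le_one))
  unfold gaussianRounding
  constructor <;> linarith [hprod.1, hprod.2]

theorem gaussianRounding_mul_gaussianRounding (u v g : E) :
    gaussianRounding u g * gaussianRounding v g =
      (4 + 2 * Real.exp ((‖u‖ ^ 2 - 1) / 2) * (Real.cos ⟪g, u⟫ + Real.sin ⟪g, u⟫) +
        2 * Real.exp ((‖v‖ ^ 2 - 1) / 2) * (Real.cos ⟪g, v⟫ + Real.sin ⟪g, v⟫) +
        Real.exp ((‖u‖ ^ 2 - 1) / 2) * Real.exp ((‖v‖ ^ 2 - 1) / 2) *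
          (Real.cos ⟪g, u - v⟫ + Real.sin ⟪g, u + v⟫)) / 16 := by
  rw [inner_sub_right, inner_add_right, Real.cos_sub, Real.sin_add]
  unfold gaussianRounding
  ring

variable [MeasurableSpace E] [BorelSpace E]

theorem integrable_cos_inner_add_sin_inner (μ : Measure E) [IsFiniteMeasure μ] (x y : E) :
    Integrable (fun g => Real.cos ⟪g, x⟫ + Real.sin ⟪g, y⟫) μ :=
  .add (.of_bound (C := 1) (by fun_prop) (.of_forall fun _ => Real.abs_cos_le_one _))
    (.of_bound (C := 1) (by fun_prop) (.of_forall fun _ => Real.abs_sin_le_one _))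

theorem integrable_gaussianRounding_mul (μ : Measure E) [IsFiniteMeasure μ] (u v : E) :
    Integrable (fun g => gaussianRounding u g * gaussianRounding v g) μ := by
  simp only [gaussianRounding_mul_gaussianRounding]
  have h := integrable_cos_inner_add_sin_inner μ
  exact ((((integrable_const _).add ((h _ _).const_mul _)).add ((h _ _).const_mul _)).add
    ((h _ _).const_mul _)).div_const _

theorem integral_cos_inner_add_sin_inner (μ : Measure E) [IsFiniteMeasure μ] (x y : E) :
    ∫ g, (Real.cos ⟪g, x⟫ + Real.sin ⟪g, y⟫) ∂μ = (charFun μ x).re + (charFun μ y).im := by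
  have hint (t : E) : Integrable (fun g => Complex.exp (⟪g, t⟫ * Complex.I)) μ :=
    .of_bound (C := 1) (by fun_prop)
      (.of_forall fun _ => (Complex.norm_exp_ofReal_mul_I _).le)
  have hre := integral_re (hint x)
  have him := integral_im (hint y)
  have hadd := integral_add (hint x).re (hint y).im
  rw [hre, him] at hadd
  simpa only [charFun_apply, RCLike.re_eq_complex_re, RCLike.im_eq_complex_im,
    Complex.exp_ofReal_mul_I_re, Complex.exp_ofReal_mul_I_im] using hadd

variable [FiniteDimensional ℝ E]

theorem integral_cos_inner_add_sin_inner_stdGaussian (x y : E) :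
    ∫ g, (Real.cos ⟪g, x⟫ + Real.sin ⟪g, y⟫) ∂stdGaussian E = Real.exp (-‖x‖ ^ 2 / 2) := by
  have hcast (t : E) : Complex.exp (-‖t‖ ^ 2 / 2) = (Real.exp (-‖t‖ ^ 2 / 2) : ℝ) := by
    push_cast
    rfl
  rw [integral_cos_inner_add_sin_inner, charFun_stdGaussian, charFun_stdGaussian, hcast, hcast,
    Complex.ofReal_re, Complex.ofReal_im, add_zero]

theorem integral_gaussianRounding_mul (u v : E) :
    ∫ g, gaussianRounding u g * gaussianRounding v g ∂stdGaussian E = roundingWeight ⟪u, v⟫ := by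
  have h (c : ℝ) (x y : E) := (integrable_cos_inner_add_sin_inner (stdGaussian E) x y).const_mul c
  have hself (w : E) : Real.exp ((‖w‖ ^ 2 - 1) / 2) * Real.exp (-‖w‖ ^ 2 / 2) =
      Real.exp (-1 / 2) := by
    rw [← Real.exp_add]
    ring_nf
  have hcross : Real.exp ((‖u‖ ^ 2 - 1) / 2) * Real.exp ((‖v‖ ^ 2 - 1) / 2) *
      Real.exp (-‖u - v‖ ^ 2 / 2) = Real.exp (⟪u, v⟫ - 1) := by
    rw [← Real.exp_add, ← Real.exp_add, norm_sub_sq_real]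
    ring_nf
  simp only [gaussianRounding_mul_gaussianRounding]
  rw [integral_div, integral_add (((integrable_const _).fun_add (h _ _ _)).fun_add (h _ _ _))
    (h _ _ _), integral_add ((integrable_const _).fun_add (h _ _ _)) (h _ _ _),
    integral_add (integrable_const _) (h _ _ _)]
  simp only [integral_const_mul, integral_cos_inner_add_sin_inner_stdGaussian, integral_const,
    probReal_univ, one_smul, roundingWeight]
  linear_combination (2 * hself u + 2 * hself v + hcross) / 16

theorem isRectangleMixture_roundingWeight_inner {A B : Type*} [Fintype A] [Fintype B]
    {u : A → E} {v : B → E} (hu : ∀ a, ‖u a‖ ≤ 1) (hv : ∀ b, ‖v b‖ ≤ 1) :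
    IsRectangleMixture fun a b => roundingWeight ⟪u a, v b⟫ := by
  simp only [← integral_gaussianRounding_mul]
  exact .integral (fun g => .of_mem_Icc (fun a => gaussianRounding_mem_Icc (hu a) g)
    fun b => gaussianRounding_mem_Icc (hv b) g) fun a b => integrable_gaussianRounding_mul _ _ _

end GaussianRounding

theorem one_fourth_le_roundingWeight (s : ℝ) : 1 / 4 ≤ roundingWeight s := by
  unfold roundingWeight
  linarith [Real.exp_pos (-1 / 2), Real.exp_pos (s - 1)]

theorem roundingWeight_le_mul_exp {s : ℝ} (hs : -1 ≤ s) :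
    roundingWeight s ≤ 65 * (Real.exp (s - 1) / 16) := by
  have hhalf : Real.exp (-1 / 2) ≤ 1 := Real.exp_le_one_iff.2 (by norm_num)
  have hlower : 1 / 8 ≤ Real.exp (s - 1) :=
    calc (1 / 8 : ℝ) ≤ (Real.exp 1 ^ 2)⁻¹ := by
          rw [one_div]
          gcongr
          nlinarith [Real.exp_one_lt_d9, Real.exp_pos 1]
      _ = Real.exp (-2) := by rw [← Real.exp_nat_mul, ← Real.exp_neg]; norm_num
      _ ≤ Real.exp (s - 1) := Real.exp_le_exp.2 (by linarith)
  unfold roundingWeight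
  linarith

theorem exp_div_mul_roundingWeight_le {s t : ℝ} (hs : -1 ≤ s) (hst : s ≤ t) :
    Real.exp ((t - s) / 65) * roundingWeight s ≤ roundingWeight t := by
  set y := Real.exp ((t - s) / 65) with hy
  have hy_one : 1 ≤ y := Real.one_le_exp (by linarith)
  have hy_pow : Real.exp (t - 1) = y ^ 65 * Real.exp (s - 1) := by
    rw [hy, ← Real.exp_nat_mul, ← Real.exp_add]
    ring_nf
  have hbernoulli : 65 * (y - 1) ≤ y ^ 65 - 1 := by
    have := one_add_mul_sub_le_pow (by linarith : -1 ≤ y) 65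
    norm_num at this
    linarith
  have hdiff : roundingWeight t = roundingWeight s + (y ^ 65 - 1) * (Real.exp (s - 1) / 16) := by
    unfold roundingWeight
    linarith
  calc y * roundingWeight s = roundingWeight s + (y - 1) * roundingWeight s := by ring
    _ ≤ roundingWeight s + (y - 1) * (65 * (Real.exp (s - 1) / 16)) := by
        gcongr
        exact roundingWeight_le_mul_exp hs
    _ = roundingWeight s + 65 * (y - 1) * (Real.exp (s - 1) / 16) := by ring
    _ ≤ roundingWeight s + (y ^ 65 - 1) * (Real.exp (s - 1) / 16) := by gcongr
    _ = roundingWeight t := hdiff.symm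

theorem mul_le_of_mul_pow_le_mul_pow {p q x y S : ℝ} (hp : 0 ≤ p) (hx : 0 < x)
    (hS : 1 ≤ S) (hxy : S * x ≤ y) {n : ℕ} (hn : n ≠ 0) (h : p * y ^ n ≤ q * x ^ n) :
    S * p ≤ q := by
  have hpow : S * x ^ n ≤ y ^ n :=
    calc S * x ^ n ≤ S ^ n * x ^ n := by
          gcongr
          exact le_self_pow₀ hS hn
      _ ≤ y ^ n := by rw [← mul_pow]; gcongr
  refine le_of_mul_le_mul_right (h.trans' ?_) (pow_pos hx n)
  calc S * p * x ^ n = p * (S * x ^ n) := by ring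
    _ ≤ p * y ^ n := by gcongr

theorem exists_dominating_tilt {ι : Type*} {V : Finset ι} (hV : V.Nonempty) {p ρ : ι → ℝ} {S : ℝ}
    (hS : 1 ≤ S) (hp : ∀ v ∈ V, 0 ≤ p v) (hρ : ∀ v ∈ V, 0 < ρ v)
    (hgap : ∀ v ∈ V, ∀ w ∈ V, v ≠ w → S * ρ v ≤ ρ w ∨ S * ρ w ≤ ρ v) :
    ∃ k < 2 * V.card, ∃ m ∈ V, ∀ v ∈ V, v ≠ m → S * (p v * ρ v ^ k) ≤ p m * ρ m ^ k := by
  -- Some `m` maximizes `p v * ρ v ^ (2 * j)` at two exponents. Strictly between them it dominates: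
  -- compare values of smaller `ρ` with the lower exponent, those of larger `ρ` with the upper one.
  choose m hmV hm using fun j : ℕ => V.exists_max_image (fun v => p v * ρ v ^ (2 * j)) hV
  obtain ⟨i, hi, j, hj, hij, hmij⟩ : ∃ i ∈ Finset.range (V.card + 1),
      ∃ j ∈ Finset.range (V.card + 1), i ≠ j ∧ m i = m j :=
    Finset.exists_ne_map_eq_of_card_lt_of_maps_to (t := V) (by simp) fun j _ => hmV j
  wlog hlt : i < j generalizing i j
  · exact this j hj i hi hij.symm hmij.symm (hij.lt_or_gt.resolve_left hlt)
  have hjV : j ≤ V.card := Finset.mem_range_succ_iff.1 hj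
  refine ⟨2 * i + 1, by omega, m i, hmV i, fun v hv hvm => ?_⟩
  rcases hgap v hv (m i) (hmV i) hvm with hle | hle
  · calc S * (p v * ρ v ^ (2 * i + 1)) = p v * ρ v ^ (2 * i) * (S * ρ v) := by ring
      _ ≤ p (m i) * ρ (m i) ^ (2 * i) * ρ (m i) :=
        mul_le_mul (hm i v hv) hle (by have := hρ v hv; positivity)
          (mul_nonneg (hp _ (hmV i)) (pow_nonneg (hρ _ (hmV i)).le _))
      _ = p (m i) * ρ (m i) ^ (2 * i + 1) := by ring
  · refine mul_le_of_mul_pow_le_mul_pow (n := 2 * (j - i) - 1)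
      (mul_nonneg (hp v hv) (pow_nonneg (hρ v hv).le _)) (hρ _ (hmV i)) hS hle (by omega) ?_
    rw [mul_assoc, mul_assoc, ← pow_add, ← pow_add,
      show 2 * i + 1 + (2 * (j - i) - 1) = 2 * j by omega, hmij]
    exact hm j v hv

section AlmostMonochromatic

variable {A B α : Type*} [DecidableEq α] {M : Matrix A B α}

theorem isAlmostMonochromatic_of_le_sum {A' : Finset A} {B' : Finset B} {m : α} {ε L : ℝ}
    (hε : 0 < ε) (hL : 0 ≤ L) (h : L ≤ ∑ a ∈ A', ∑ b ∈ B', if M a b = m then 1 else -ε⁻¹) :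
    IsAlmostMonochromatic M A' B' ε ∧ L ≤ A'.card * B'.card := by
  rw [← Finset.sum_product' A' B' fun a b => if M a b = m then (1 : ℝ) else -ε⁻¹,
    Finset.sum_ite, Finset.sum_const, Finset.sum_const, nsmul_eq_mul, nsmul_eq_mul, mul_one,
    mul_neg, ← sub_eq_add_neg, ← div_eq_mul_inv] at h
  have hcard : ((A'.card : ℝ) * B'.card) =
      ((A' ×ˢ B').filter fun e => M e.1 e.2 = m).card +
        ((A' ×ˢ B').filter fun e => ¬M e.1 e.2 = m).card := by
    rw [← Nat.cast_add, Finset.card_filter_add_card_filter_not, Finset.card_product, Nat.cast_mul]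
  set x : ℝ := (((A' ×ˢ B').filter fun e => M e.1 e.2 = m).card : ℝ) with hx
  set y : ℝ := (((A' ×ˢ B').filter fun e => ¬M e.1 e.2 = m).card : ℝ)
  have hy : 0 ≤ y := Nat.cast_nonneg _
  have hyx : y ≤ ε * x := (div_le_iff₀' hε).1 (by linarith)
  refine ⟨⟨m, ?_⟩, ?_⟩
  · rw [← hx, hcard]
    linarith [mul_nonneg hε.le hy]
  · rw [hcard]
    linarith [div_nonneg hy hε.le]

theorem sum_div_four_le_sum_ite_mul {V : Finset α} {q : α → ℝ} {m : α} {ε : ℝ} (hm : m ∈ V)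
    (hq : ∀ v ∈ V, 0 ≤ q v) (hε : 0 < ε) (hε1 : ε ≤ 1)
    (hdom : ∀ v ∈ V, v ≠ m → 2 * V.card / ε * q v ≤ q m) :
    (∑ v ∈ V, q v) / 4 ≤ ∑ v ∈ V, (if v = m then 1 else -ε⁻¹) * q v := by
  have hV : 0 < (V.card : ℝ) := Nat.cast_pos.2 (Finset.card_pos.2 ⟨m, hm⟩)
  have hterm : ∀ v ∈ V.erase m, q v ≤ ε * q m / (2 * V.card) := fun v hv => by
    have := hdom v (Finset.mem_of_mem_erase hv) (Finset.ne_of_mem_erase hv)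
    rw [div_mul_eq_mul_div, div_le_iff₀ hε] at this
    rw [le_div_iff₀ (by positivity)]
    linarith
  have hrest : ∑ v ∈ V.erase m, q v ≤ ε * q m / 2 :=
    calc ∑ v ∈ V.erase m, q v ≤ (V.erase m).card * (ε * q m / (2 * V.card)) := by
          simpa only [nsmul_eq_mul] using Finset.sum_le_card_nsmul _ _ _ hterm
      _ ≤ V.card * (ε * q m / (2 * V.card)) := by
          have := hq m hm
          gcongr
          exact Finset.erase_subset m V
      _ = ε * q m / 2 := by field_simp
  have hsum : ∑ v ∈ V.erase m, (if v = m then 1 else -ε⁻¹) * q v =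
      -(ε⁻¹ * ∑ v ∈ V.erase m, q v) := by
    rw [Finset.mul_sum, ← Finset.sum_neg_distrib]
    exact Finset.sum_congr rfl fun v hv => by rw [if_neg (Finset.ne_of_mem_erase hv), neg_mul]
  have hinv : ε⁻¹ * ∑ v ∈ V.erase m, q v ≤ q m / 2 := by
    rw [inv_mul_le_iff₀ hε]
    linarith
  rw [← Finset.add_sum_erase _ _ hm, ← Finset.add_sum_erase V (fun v => _ * _) hm, hsum, if_pos rfl]
  linarith [mul_le_of_le_one_left (hq m hm) hε1, hq m hm]

variable [Fintype A] [Fintype B]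

/-- The number of entries of `M` with value `v`. -/
def entryCount (M : Matrix A B α) (v : α) : ℕ :=
  (Finset.univ.filter fun e : A × B => M e.1 e.2 = v).card

theorem sum_sum_comp_eq_sum_entryCount_mul {V : Finset α} (hM : ∀ a b, M a b ∈ V) (F : α → ℝ) :
    ∑ a, ∑ b, F (M a b) = ∑ v ∈ V, entryCount M v * F v := by
  rw [← Fintype.sum_prod_type' fun a b => F (M a b),
    ← Finset.sum_fiberwise_of_maps_to' (g := fun e : A × B => M e.1 e.2) fun e _ => hM e.1 e.2]
  simp only [Finset.sum_const, nsmul_eq_mul, entryCount]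

theorem IsRectangleMixture.exists_isAlmostMonochromatic {V : Finset α} (hV : V.Nonempty)
    (hM : ∀ a b, M a b ∈ V) {ω : α → ℝ} (hω : IsRectangleMixture fun a b => ω (M a b)) {c ε : ℝ}
    (hc : 0 < c) (hc1 : c ≤ 1) (hcω : ∀ v ∈ V, c ≤ ω v) (hε : 0 < ε) (hε1 : ε ≤ 1)
    (hgap : ∀ v ∈ V, ∀ w ∈ V, v ≠ w →
      2 * V.card / ε * ω v ≤ ω w ∨ 2 * V.card / ε * ω w ≤ ω v) :
    ∃ (A' : Finset A) (B' : Finset B), IsAlmostMonochromatic M A' B' ε ∧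
      Fintype.card A * Fintype.card B * (c ^ (2 * V.card) / 4) ≤ (A'.card * B'.card : ℝ) := by
  have hcount := sum_sum_comp_eq_sum_entryCount_mul hM
  have hS : 1 ≤ 2 * V.card / ε := by
    have : (1 : ℝ) ≤ V.card := Nat.one_le_cast.2 hV.card_pos
    rw [one_le_div hε]
    linarith
  obtain ⟨k, hk, m, hmV, hdom⟩ := exists_dominating_tilt hV (p := fun v => entryCount M v)
    hS (fun _ _ => Nat.cast_nonneg _) (fun v hv => hc.trans_le (hcω v hv)) hgap
  obtain ⟨A', B', hAB⟩ := hω.pow k fun a b => if M a b = m then 1 else -ε⁻¹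
  have htotal : Fintype.card A * Fintype.card B * (c ^ (2 * V.card) / 4) ≤
      (∑ v ∈ V, entryCount M v * ω v ^ k) / 4 := by
    have hall : (Fintype.card A * Fintype.card B : ℝ) = ∑ v ∈ V, (entryCount M v : ℝ) := by
      simpa using hcount 1
    rw [← mul_div_assoc, hall, Finset.sum_mul]
    gcongr with v hv
    exact (pow_le_pow_of_le_one hc.le hc1 hk.le).trans (pow_le_pow_left₀ hc.le (hcω v hv) k)
  have hexcess : (∑ v ∈ V, entryCount M v * ω v ^ k) / 4 ≤
      ∑ a, ∑ b, (if M a b = m then 1 else -ε⁻¹) * ω (M a b) ^ k := by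
    rw [hcount fun x => (if x = m then 1 else -ε⁻¹) * ω x ^ k]
    simpa only [mul_left_comm] using sum_div_four_le_sum_ite_mul hmV (fun v hv =>
      mul_nonneg (Nat.cast_nonneg _) (pow_nonneg (hc.trans_le (hcω v hv)).le _)) hε hε1 hdom
  obtain ⟨hmono, hsize⟩ := isAlmostMonochromatic_of_le_sum hε (by positivity)
    (htotal.trans (hexcess.trans hAB))
  exact ⟨A', B', hmono, hsize⟩

end AlmostMonochromatic

theorem mul_roundingWeight_pow_le_or_le {s t d S : ℝ} {T : ℕ} (hs : -1 ≤ s) (ht : -1 ≤ t)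
    (hst : d ≤ |s - t|) (hS : 0 < S) (hT : 65 * Real.log S ≤ d * T) :
    S * roundingWeight s ^ T ≤ roundingWeight t ^ T ∨
      S * roundingWeight t ^ T ≤ roundingWeight s ^ T := by
  wlog hle : s ≤ t generalizing s t
  · exact (this ht hs (by rwa [abs_sub_comm]) (le_of_not_ge hle)).symm
  refine .inl ?_
  have hpos : 0 ≤ roundingWeight s := (one_fourth_le_roundingWeight s).trans' (by norm_num)
  calc S * roundingWeight s ^ T ≤ Real.exp ((t - s) / 65) ^ T * roundingWeight s ^ T := by
        gcongr
        rw [← Real.exp_nat_mul, ← Real.log_le_iff_le_exp hS]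
        rw [abs_sub_comm, abs_of_nonneg (sub_nonneg.2 hle)] at hst
        linarith [mul_le_mul_of_nonneg_right hst (Nat.cast_nonneg (α := ℝ) T)]
    _ ≤ roundingWeight t ^ T := by
        rw [← mul_pow]
        gcongr
        exact exp_div_mul_roundingWeight_le hs hle

theorem exp_neg_le_one_fourth_pow {N T : ℕ} {x : ℝ} (hN : 1 ≤ N) (hx : Real.log 2 ≤ x)
    (hT : T ≤ 65 * x + 1) : Real.exp (-(200 * N * x)) ≤ ((1 / 4) ^ T) ^ (2 * N) / 4 := by
  have hfour : (4 : ℝ) = Real.exp (2 * Real.log 2) := by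
    rw [mul_comm, Real.exp_mul, Real.exp_log two_pos]
    norm_num
  have hN' : (1 : ℝ) ≤ N := Nat.one_le_cast.2 hN
  have hexponent : 2 * Real.log 2 * (T * (2 * N) + 1) ≤ 200 * N * x :=
    calc 2 * Real.log 2 * (T * (2 * N) + 1)
      _ ≤ 2 * Real.log 2 * ((65 * x + 1) * (2 * N) + N) := by gcongr
      _ = 2 * Real.log 2 * (130 * x + 3) * N := by ring
      _ ≤ 200 * x * N := by
        refine mul_le_mul_of_nonneg_right ?_ (Nat.cast_nonneg N)
        nlinarith [Real.log_two_gt_d9, Real.log_two_lt_d9]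
      _ = 200 * N * x := by ring
  calc Real.exp (-(200 * N * x)) ≤ Real.exp (-(2 * Real.log 2 * (T * (2 * N) + 1))) := by gcongr
    _ = ((1 / 4) ^ T) ^ (2 * N) / 4 := by
      rw [← pow_mul, one_div, inv_pow, ← one_div, div_div, ← pow_succ, Real.exp_neg,
        hfour, ← Real.exp_nat_mul, one_div]
      push_cast
      ring_nf

theorem GammaTwoLE.abs_le {A B : Type*} {M : Matrix A B ℝ} {γ : ℝ} (h : GammaTwoLE M γ)
    (hγ : 0 ≤ γ) (a : A) (b : B) : |M a b| ≤ γ := by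
  obtain ⟨k, u, v, hu, hv, hM⟩ := h
  rw [hM, abs_mul, abs_of_nonneg hγ]
  exact mul_le_of_le_one_right hγ ((abs_real_inner_le_norm _ _).trans
    (mul_le_one₀ (hu a) (norm_nonneg _) (hv b)))

section Separated

variable {A B α : Type*} [Fintype A] [Fintype B] [DecidableEq α] {M : Matrix A B α} {V : Finset α}
  {f : α → ℝ} {δ ε : ℝ}

theorem GammaTwoLE.exists_isAlmostMonochromatic {γ : ℝ} (h : GammaTwoLE (M.map f) γ)
    (hV : V.Nonempty) (hM : ∀ a b, M a b ∈ V) (hf : ∀ x ∈ V, |f x| ≤ γ) (hδ : 0 < δ) (hδγ : δ ≤ γ)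
    (hsep : (V : Set α).Pairwise fun x y => δ ≤ |f x - f y|) (hε : 0 < ε) (hε1 : ε ≤ 1) :
    ∃ (A' : Finset A) (B' : Finset B), IsAlmostMonochromatic M A' B' ε ∧
      Fintype.card A * Fintype.card B *
        Real.exp (-(200 * V.card * (γ / δ * Real.log (2 * V.card / ε)))) ≤
          (A'.card * B'.card : ℝ) := by
  have hγ : 0 < γ := hδ.trans_le hδγ
  have hS : 2 ≤ 2 * V.card / ε := by
    have : (1 : ℝ) ≤ V.card := Nat.one_le_cast.2 hV.card_pos
    rw [le_div_iff₀ hε]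
    linarith
  set S := 2 * V.card / ε
  have hx : Real.log 2 ≤ γ / δ * Real.log S :=
    (Real.log_le_log two_pos hS).trans
      (le_mul_of_one_le_left (Real.log_nonneg (by linarith)) ((one_le_div hδ).2 hδγ))
  set T := ⌈65 * (γ / δ * Real.log S)⌉₊
  have hTS : 65 * Real.log S ≤ δ / γ * T :=
    calc 65 * Real.log S = δ / γ * (65 * (γ / δ * Real.log S)) := by field_simp
      _ ≤ δ / γ * T := by
        gcongr
        exact Nat.le_ceil _
  have hfγ : ∀ x ∈ V, -1 ≤ f x / γ := fun x hx => by
    rw [le_div_iff₀ hγ]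
    linarith [_root_.abs_le.1 (hf x hx)]
  obtain ⟨k, u, v, hu, hv, huv⟩ := h
  have hω : IsRectangleMixture fun a b => roundingWeight (f (M a b) / γ) ^ T := by
    convert (isRectangleMixture_roundingWeight_inner hu hv).pow T with a b
    rw [← M.map_apply (f := f), huv, mul_div_cancel_left₀ _ hγ.ne']
  obtain ⟨A', B', hmono, hsize⟩ := hω.exists_isAlmostMonochromatic
    (ω := fun x => roundingWeight (f x / γ) ^ T) (c := (1 / 4) ^ T) hV hM
    (by positivity) (pow_le_one₀ (by norm_num) (by norm_num))
    (fun x _ => pow_le_pow_left₀ (by norm_num) (one_fourth_le_roundingWeight _) T) hε hε1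
    fun x hx y hy hxy => mul_roundingWeight_pow_le_or_le (hfγ x hx) (hfγ y hy)
      (by rw [← sub_div, abs_div, abs_of_pos hγ]; gcongr; exact hsep hx hy hxy) (by linarith) hTS
  refine ⟨A', B', hmono, hsize.trans' ?_⟩
  gcongr
  exact exp_neg_le_one_fourth_pow hV.card_pos hx
    (Nat.ceil_lt_add_one (by linarith [Real.log_two_gt_d9])).le

theorem mainTheorem4_general (hV : V.Nonempty) (hM : ∀ a b, M a b ∈ V) {D : ℝ} (hD : 0 ≤ D)
    (hf : ∀ a b, |f (M a b)| ≤ D) (hδ : 0 < δ)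
    (hsep : (V : Set α).Pairwise fun x y => δ ≤ |f x - f y|) (hε : 0 < ε) (hε1 : ε ≤ 1) :
    ∃ (A' : Finset A) (B' : Finset B), IsAlmostMonochromatic M A' B' ε ∧
      Fintype.card A * Fintype.card B * Real.exp
        (-(200 * V.card * ((√(M.map f).rank * D + δ) / δ * Real.log (2 * V.card / ε)))) ≤
          (A'.card * B'.card : ℝ) := by
  rcases isEmpty_or_nonempty (A × B) with hempty | ⟨a₀, b₀⟩
  · have hcard : (Fintype.card A * Fintype.card B : ℝ) = 0 := by
      rw [← Nat.cast_mul, ← Fintype.card_prod, Fintype.card_eq_zero, Nat.cast_zero]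
    exact ⟨∅, ∅, ⟨hV.choose, by simp⟩, by simp [hcard]⟩
  have hγ₂ : GammaTwoLE (M.map f) (√(M.map f).rank * D + δ) := by
    refine (gammaTwoLE_sqrt_rank_mul (M := M.map f) hD hf).mono ?_
    rw [abs_of_nonneg (by positivity)]
    linarith
  set γ := √(M.map f).rank * D + δ
  have hδγ : δ ≤ γ := le_add_of_nonneg_left (by positivity)
  let V' : Finset α := Finset.univ.image fun e : A × B => M e.1 e.2
  have hV'V : V' ⊆ V := Finset.image_subset_iff.2 fun e _ => hM e.1 e.2
  have hV' : V'.Nonempty := ⟨_, Finset.mem_image_of_mem _ (Finset.mem_univ (a₀, b₀))⟩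
  obtain ⟨A', B', hmono, hsize⟩ := hγ₂.exists_isAlmostMonochromatic hV'
    (fun a b => Finset.mem_image_of_mem _ (Finset.mem_univ (a, b)))
    (Finset.forall_mem_image.2 fun e _ => hγ₂.abs_le (by linarith) e.1 e.2) hδ hδγ
    (hsep.mono (Finset.coe_subset.2 hV'V)) hε hε1
  refine ⟨A', B', hmono, hsize.trans' ?_⟩
  have hlog : 0 ≤ Real.log (2 * V'.card / ε) := by
    have : (1 : ℝ) ≤ V'.card := Nat.one_le_cast.2 hV'.card_pos
    exact Real.log_nonneg ((one_le_div hε).2 (by linarith))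
  gcongr

end Separated

theorem succ_pow_three_le_eight_mul_pow (Δ : ℕ) {C : ℕ} (hC : 3 ≤ C) :
    (Δ + 1) ^ 3 ≤ 8 * Δ ^ (C * Δ) := by
  rcases Δ.eq_zero_or_pos with rfl | hΔ
  · simp
  calc (Δ + 1) ^ 3 ≤ (2 * Δ) ^ 3 := by gcongr; omega
    _ = 8 * Δ ^ 3 := by ring
    _ ≤ 8 * Δ ^ (C * Δ) := by
      gcongr
      exact hC.trans (Nat.le_mul_of_pos_right C hΔ)

theorem log_mul_succ_div_le {r : ℝ} (hr : 2 ≤ r) (Δ : ℕ) :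
    Real.log (2 * (Δ + 1) / (1 / (16 * r))) ≤ 6 * (Δ + 1) * Real.log r := by
  have hlog : Real.log 2 ≤ Real.log r := Real.log_le_log two_pos hr
  have harg : 2 * ((Δ : ℝ) + 1) / (1 / (16 * r)) = 2 ^ 5 * r * (Δ + 1) := by
    field_simp
    norm_num
  have hsucc : Real.log (Δ + 1) ≤ Δ := by
    linarith [Real.log_le_sub_one_of_pos (Nat.cast_add_one_pos (α := ℝ) Δ)]
  rw [harg, Real.log_mul (by positivity) (by positivity), Real.log_mul (by positivity)
    (by positivity), Real.log_pow]
  push_cast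
  have hΔ : (Δ : ℝ) ≤ 6 * Δ * Real.log r := by
    nlinarith [Real.log_two_gt_d9, Nat.cast_nonneg (α := ℝ) Δ]
  linarith

theorem mul_mul_log_le_mul_pow {r : ℝ} (hr : 2 ≤ r) (Δ : ℕ) :
    200 * (Δ + 1) * ((√r * Δ + 1) / 1 * Real.log (2 * (Δ + 1) / (1 / (16 * r)))) ≤
      9600 * (Δ : ℝ) ^ (9600 * Δ) * √r * Real.log r := by
  have hsqrt : 1 ≤ √r := Real.one_le_sqrt.2 (by linarith)
  have hlog : 0 ≤ Real.log r := Real.log_nonneg (by linarith)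
  have harg : 1 ≤ 2 * ((Δ : ℝ) + 1) / (1 / (16 * r)) := by
    rw [le_div_iff₀ (by positivity), one_mul, div_le_iff₀ (by positivity)]
    nlinarith [Nat.cast_nonneg (α := ℝ) Δ]
  have hcube : ((Δ : ℝ) + 1) ^ 3 ≤ 8 * (Δ : ℝ) ^ (9600 * Δ) := by
    exact_mod_cast succ_pow_three_le_eight_mul_pow Δ (by norm_num : 3 ≤ 9600)
  calc _ ≤ 200 * (Δ + 1) * ((√r * (Δ + 1)) / 1 * (6 * (Δ + 1) * Real.log r)) := by
        gcongr
        · exact Real.log_nonneg harg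
        · linarith
        · exact log_mul_succ_div_le hr Δ
    _ = 1200 * ((Δ : ℝ) + 1) ^ 3 * √r * Real.log r := by ring
    _ ≤ 1200 * (8 * (Δ : ℝ) ^ (9600 * Δ)) * √r * Real.log r := by gcongr
    _ = 9600 * (Δ : ℝ) ^ (9600 * Δ) * √r * Real.log r := by ring

theorem mainTheorem4 :
    ∃ C : ℕ, 0 < C ∧
      ∀ (A B : Type*) [Fintype A] [Fintype B] (Δ r : ℕ) (M : Matrix A B ℕ),
        (∀ a b, M a b ≤ Δ) →
        (M.map (fun n : ℕ => (n : ℝ))).rank = r →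
        2 ≤ r →
        ∃ (A' : Finset A) (B' : Finset B),
          IsAlmostMonochromatic M A' B' (1 / (16 * (r : ℝ))) ∧
          (Fintype.card A : ℝ) * (Fintype.card B : ℝ) *
              Real.exp (-((C : ℝ) * (Δ : ℝ) ^ (C * Δ) * Real.sqrt r * Real.log r)) ≤
            (A'.card : ℝ) * (B'.card : ℝ) := by
  refine ⟨9600, by norm_num, fun A B _ _ Δ r M hM hrank hr => ?_⟩
  have hr' : (2 : ℝ) ≤ r := Nat.ofNat_le_cast.2 hr
  have hsep : ((Finset.range (Δ + 1) : Finset ℕ) : Set ℕ).Pairwise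
      fun x y => (1 : ℝ) ≤ |(x : ℝ) - y| := fun x _ y _ hxy => by
    exact_mod_cast Int.one_le_abs (sub_ne_zero.2 (Nat.cast_injective.ne hxy))
  obtain ⟨A', B', hmono, hsize⟩ := mainTheorem4_general (M := M) (f := Nat.cast) (D := Δ)
    (ε := 1 / (16 * r)) Finset.nonempty_range_add_one
    (fun a b => Finset.mem_range_succ_iff.2 (hM a b)) (Nat.cast_nonneg Δ)
    (fun a b => by rw [Nat.abs_cast]; exact Nat.cast_le.2 (hM a b)) one_pos hsep
    (by positivity) (by rw [div_le_one (by positivity)]; linarith)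
  refine ⟨A', B', hmono, hsize.trans' ?_⟩
  rw [hrank, Finset.card_range]
  push_cast
  refine mul_le_mul_of_nonneg_left (Real.exp_le_exp.2 (neg_le_neg ?_)) (by positivity)
  exact mul_mul_log_le_mul_pow hr' Δ
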